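/- Let $a>0$ and let $H$ and $G$ be probability measures on $\mathbb{R}$ (identified with their cdf's). On a probability space let $(E_k)_{k\ge1}$ be i.i.d. exponential$(1)$ random variables, $\Gamma_i=E_1+\cdots+E_i$, and let $(Y_i)_{i\ge1}$ be i.i.d. with distribution $H$, independent of $(\Gamma_i)_{i\ge1}$. Let $P$ be the Dirichlet process $DP(a,H)$ given by Ferguson's series $$P=\sum_{i=1}^{\infty}\frac{L^{-1}(\Gamma_i)}{\sum_{j=1}^{\infty}L^{-1}(\Gamma_j)}\,\delta_{Y_i},\qquad L(x)=a\int_x^\infty t^{-1}e^{-t}\,dt\ \ (x>0),\qquad L^{-1}(y)=\inf\{x>0: L(x)\le y\},$$ and for $N\ge1$ let $$P_N=\sum_{i=1}^{N}J_i\,\delta_{Y_i},\qquad J_i=\frac{G_{a/N}^{-1}(\Gamma_i/\Gamma_{N+1})}{\sum_{j=1}^{N}G_{a/N}^{-1}(\Gamma_j/\Gamma_{N+1})},$$ where $G_{a/N}$ is the co-cdf of the gamma$(a/N,1)$ distribution, so that $G_{a/N}^{-1}(p)=\inf\{x: G_{a/N}(x)\le p\}$ is its $(1-p)$-quantile. For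 cdf's $F$ and $G$ put $d_{CvM}(F,G)=\int_{-\infty}^{\infty}(F(x)-G(x))^2\,G(dx)$. Then, almost surely, $P$ and all $P_N$ $(N\ge1)$ are probability measures and $$d_{CvM}(P_N,G)\longrightarrow d_{CvM}(P,G)\qquad\text{as } N\to\infty .$$ -/

import Mathlib

open MeasureTheory ProbabilityTheory Filter Topology

noncomputable section

/-- The Cramér–von Mises distance `∫ (F(x) - G(x))² G(dx)` between the cdfs of two laws on `ℝ`. -/
def dCvM (F G : Measure ℝ) : ℝ :=
  ∫ x, (cdf F x - cdf G x) ^ 2 ∂G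

/-- `L(x) = a ∫_x^∞ t⁻¹ e^{-t} dt`, for `x > 0`. -/
def levyTail (a x : ℝ) : ℝ :=
  a * ∫ t in Set.Ioi x, t⁻¹ * Real.exp (-t)

/-- The inverse `L⁻¹(y)` of the decreasing function `L` on `(0, ∞)`. -/
def levyTailInv (a y : ℝ) : ℝ :=
  sInf {x : ℝ | 0 < x ∧ levyTail a x ≤ y}

/-- The co-cdf of the gamma distribution with shape `α` and rate `1`. -/
def gammaCoCDF (α x : ℝ) : ℝ :=
  (gammaMeasure α 1).real (Set.Ioi x)

/-- The inverse of the co-cdf: the `(1 - p)`-quantile of the gamma distribution with shape `α`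
and rate `1`. -/
def gammaCoCDFInv (α p : ℝ) : ℝ :=
  sInf {x : ℝ | gammaCoCDF α x ≤ p}

variable {Ω : Type*}

/-- The arrival times `Γ_n = E_1 + ⋯ + E_n`. Sequences are indexed from `0`, so that `E k` is
the variable `E_{k+1}`. -/
def arrival (E : ℕ → Ω → ℝ) (n : ℕ) (ω : Ω) : ℝ :=
  ∑ k ∈ Finset.range n, E k ω

/-- Ferguson's series for the Dirichlet process with concentration `a`, at the sample point `ω`:
`∑ L⁻¹(Γ_i) δ_{Y_i} / ∑ L⁻¹(Γ_i)`. -/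
def fergusonSeries (a : ℝ) (E Y : ℕ → Ω → ℝ) (ω : Ω) : Measure ℝ :=
  Measure.sum fun i : ℕ =>
    ENNReal.ofReal (levyTailInv a (arrival E (i + 1) ω) /
        ∑' j : ℕ, levyTailInv a (arrival E (j + 1) ω)) •
      Measure.dirac (Y i ω)

/-- The weight attached to the atom `Y i` in the finite approximation with `N` atoms:
`G_{a/N}⁻¹(Γ_i / Γ_{N+1}) / ∑_{j ≤ N} G_{a/N}⁻¹(Γ_j / Γ_{N+1})`. -/
def approxWeight (a : ℝ) (E : ℕ → Ω → ℝ) (N i : ℕ) (ω : Ω) : ℝ :=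
  gammaCoCDFInv (a / N) (arrival E (i + 1) ω / arrival E (N + 1) ω) /
    ∑ j ∈ Finset.range N, gammaCoCDFInv (a / N) (arrival E (j + 1) ω / arrival E (N + 1) ω)

/-- The finite approximation `P_N = ∑_{i ≤ N} J_i δ_{Y_i}`, at the sample point `ω`. -/
def approxProcess (a : ℝ) (E Y : ℕ → Ω → ℝ) (N : ℕ) (ω : Ω) : Measure ℝ :=
  ∑ i ∈ Finset.range N, ENNReal.ofReal (approxWeight a E N i ω) • Measure.dirac (Y i ω)

end

/-!
Both inverses are generalised inverses of upper incomplete gamma functions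
`Γ(s, x) = ∫_x^∞ t^(s-1) e^{-t} dt`: the Lévy tail is `a Γ(0, ·)` and the gamma co-cdf is
`Γ(α, ·) / Γ(α)`. Writing `S_i` for the arrival times, the unnormalised weights of `P_N` are
therefore the inverses of `Γ(a/N, ·)` at `(Γ(a/N) / S_{N+1}) S_i`, and those of `P` are the inverses
of `Γ(0, ·)` at `S_i / a`. By the law of large numbers and `x Γ(x) → 1` at `0`, the factor
`Γ(a/N) / S_{N+1}` tends to `1 / a`, so the weights converge one by one. The bound
`Γ(s, x) ≤ 4 / √x` for `0 ≤ s ≤ 1` makes the inverse at `y` at most `16 / y²`, and `∑ S_i⁻²`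
converges, so dominated convergence applies to the sums. It follows that `P_N(B) → P(B)` for every
Borel set `B`, and bounded convergence under `G` concludes.
-/

section TailInv

/-- The generalised inverse `inf {x > 0 : f x ≤ y}` of a non-increasing function on `(0, ∞)`; it is
`0` when `f` stays above `y` there. -/
noncomputable def tailInv (f : ℝ → ℝ) (y : ℝ) : ℝ :=
  sInf {x : ℝ | 0 < x ∧ f x ≤ y}

variable {f : ℝ → ℝ} {x y : ℝ}

lemma tailInv_nonneg (f : ℝ → ℝ) (y : ℝ) : 0 ≤ tailInv f y :=
  Real.sInf_nonneg fun _ hx => hx.1.le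

lemma tailInv_le (hx : 0 < x) (hxy : f x ≤ y) : tailInv f y ≤ x :=
  csInf_le ⟨0, fun _ hz => hz.1.le⟩ ⟨hx, hxy⟩

lemma lt_of_lt_tailInv (hx : 0 < x) (h : x < tailInv f y) : y < f x :=
  lt_of_not_ge fun hle => h.not_ge (tailInv_le hx hle)

lemma le_tailInv (hf : AntitoneOn f (Set.Ioi 0)) (hne : ∃ z, 0 < z ∧ f z ≤ y) (hx : 0 < x)
    (hxy : y < f x) : x ≤ tailInv f y :=
  le_csInf hne fun _ hz =>
    le_of_not_gt fun hzx => (hxy.trans_le (hf hz.1 hx hzx.le)).not_ge hz.2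

lemma lt_of_tailInv_lt (hf : StrictAntiOn f (Set.Ioi 0)) (hne : ∃ z, 0 < z ∧ f z ≤ y)
    (h : tailInv f y < x) : f x < y := by
  obtain ⟨z, ⟨hz, hzy⟩, hzx⟩ := exists_lt_of_csInf_lt hne h
  exact (hf hz (hz.trans hzx) hzx).trans_le hzy

lemma tailInv_const_mul {c : ℝ} (hc : 0 < c) (f : ℝ → ℝ) (y : ℝ) :
    tailInv (fun x => c * f x) y = tailInv f (y / c) := by
  simp only [tailInv, le_div_iff₀' hc]

lemma tendsto_tailInv {ι : Type*} {l : Filter ι} {F : ι → ℝ → ℝ} {Y : ι → ℝ}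
    (hF : ∀ᶠ i in l, AntitoneOn (F i) (Set.Ioi 0)) (hf : StrictAntiOn f (Set.Ioi 0))
    (hFf : ∀ x, 0 < x → Tendsto (fun i => F i x) l (𝓝 (f x))) (hY : Tendsto Y l (𝓝 y))
    (hne : ∃ z, 0 < z ∧ f z ≤ y) :
    Tendsto (fun i => tailInv (F i) (Y i)) l (𝓝 (tailInv f y)) := by
  have eventually_le : ∀ x, tailInv f y < x → ∀ᶠ i in l, 0 < x ∧ F i x ≤ Y i := fun x hx => by
    have hx0 : 0 < x := (tailInv_nonneg f y).trans_lt hx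
    filter_upwards [(hFf x hx0).eventually_lt hY (lt_of_tailInv_lt hf hne hx)] with i hi
    exact ⟨hx0, hi.le⟩
  refine tendsto_order.2 ⟨fun b hb => ?_, fun b hb => ?_⟩
  · rcases lt_or_ge b 0 with hb0 | hb0
    · exact .of_forall fun i => hb0.trans_le (tailInv_nonneg _ _)
    · obtain ⟨c, hbc, hc⟩ := exists_between hb
      have hc0 : 0 < c := hb0.trans_lt hbc
      filter_upwards [hF, eventually_le _ (lt_add_one _),
        hY.eventually_lt (hFf c hc0) (lt_of_lt_tailInv hc0 hc)] with i hFi hi hci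
      exact hbc.trans_le (le_tailInv hFi ⟨_, hi⟩ hc0 hci)
  · obtain ⟨c, hc, hcb⟩ := exists_between hb
    filter_upwards [eventually_le c hc] with i hi
    exact (tailInv_le hi.1 hi.2).trans_lt hcb

end TailInv

section UpperGamma

/-- The upper incomplete gamma function `Γ(s, x) = ∫_x^∞ t^(s-1) e^{-t} dt`, of which the Lévy tail
(`s = 0`) and the gamma co-cdfs are multiples. At `x = 0` and `s ≤ 0` the integral diverges and the
value is `0`. -/
noncomputable def upperGamma (s x : ℝ) : ℝ :=
  ∫ t in Set.Ioi x, t ^ (s - 1) * Real.exp (-t)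

variable {s x y : ℝ}

lemma rpow_le_rpow_add_rpow {t p q r : ℝ} (ht : 0 < t) (hpq : p ≤ q) (hqr : q ≤ r) :
    t ^ q ≤ t ^ p + t ^ r := by
  rcases le_total t 1 with h | h
  · exact (Real.rpow_le_rpow_of_exponent_ge ht h hpq).trans
      (le_add_of_nonneg_right (by positivity))
  · exact (Real.rpow_le_rpow_of_exponent_le h hqr).trans
      (le_add_of_nonneg_left (by positivity))

lemma integrableOn_rpow_mul_exp_neg_Ioi (p : ℝ) (hx : 0 < x) :
    IntegrableOn (fun t : ℝ => t ^ p * Real.exp (-t)) (Set.Ioi x) := by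
  refine integrable_of_isBigO_exp_neg (b := 1 / 2) (by norm_num) ?_ ?_
  · exact (continuousOn_id.rpow_const fun t ht => .inl (hx.trans_le ht).ne').mul
      (by fun_prop)
  · simpa only [mul_comm] using (Real.Gamma_integrand_isLittleO p).isBigO

lemma upperGamma_sub_upperGamma (s : ℝ) (hx : 0 < x) (hxy : x ≤ y) :
    upperGamma s x - upperGamma s y = ∫ t in x..y, t ^ (s - 1) * Real.exp (-t) :=
  intervalIntegral.integral_Ioi_sub_Ioi (integrableOn_rpow_mul_exp_neg_Ioi _ hx) hxy

lemma upperGamma_nonneg (s : ℝ) (hx : 0 ≤ x) : 0 ≤ upperGamma s x :=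
  setIntegral_nonneg measurableSet_Ioi fun t ht => by
    have : 0 < t := hx.trans_lt ht
    positivity

lemma strictAntiOn_upperGamma (s : ℝ) : StrictAntiOn (upperGamma s) (Set.Ioi 0) := by
  intro x hx y _ hxy
  have hx : 0 < x := hx
  rw [← sub_pos, upperGamma_sub_upperGamma s hx hxy.le]
  refine intervalIntegral.intervalIntegral_pos_of_pos_on ?_ (fun t ht => ?_) hxy
  · exact (intervalIntegrable_iff_integrableOn_Ioc_of_le hxy.le).2
      ((integrableOn_rpow_mul_exp_neg_Ioi _ hx).mono_set Set.Ioc_subset_Ioi_self)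
  · have : 0 < t := hx.trans ht.1
    positivity

lemma tendsto_upperGamma_atTop (s : ℝ) : Tendsto (upperGamma s) atTop (𝓝 0) := by
  have h := (intervalIntegral_tendsto_integral_Ioi 1
    (integrableOn_rpow_mul_exp_neg_Ioi (s - 1) one_pos) tendsto_id).const_sub (upperGamma s 1)
  rw [← upperGamma, sub_self] at h
  refine h.congr' ?_
  filter_upwards [eventually_ge_atTop 1] with x hx
  rw [id, ← upperGamma_sub_upperGamma s one_pos hx, sub_sub_cancel]

lemma continuous_upperGamma_left (hx : 0 < x) : Continuous fun s => upperGamma s x := by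
  refine continuous_iff_continuousAt.2 fun s₀ => continuousAt_of_dominated
    (bound := fun t => t ^ (s₀ - 2) * Real.exp (-t) + t ^ s₀ * Real.exp (-t))
    (.of_forall fun s => (integrableOn_rpow_mul_exp_neg_Ioi _ hx).aestronglyMeasurable) ?_
    ((integrableOn_rpow_mul_exp_neg_Ioi _ hx).add (integrableOn_rpow_mul_exp_neg_Ioi _ hx)) ?_
  · filter_upwards [Icc_mem_nhds (sub_one_lt s₀) (lt_add_one s₀)] with s hs
    filter_upwards [ae_restrict_mem measurableSet_Ioi] with t ht
    have ht : 0 < t := hx.trans ht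
    rw [Real.norm_of_nonneg (by positivity), ← add_mul]
    gcongr
    exact rpow_le_rpow_add_rpow ht (by linarith [hs.1]) (by linarith [hs.2])
  · filter_upwards [ae_restrict_mem measurableSet_Ioi] with t ht
    have ht : t ≠ 0 := (hx.trans ht).ne'
    exact ((Real.continuousAt_const_rpow ht).comp (by fun_prop)).mul continuousAt_const

lemma tendsto_upperGamma_nhdsGT_zero (hs : 0 < s) :
    Tendsto (upperGamma s) (𝓝[>] 0) (𝓝 (Real.Gamma s)) := by
  simp only [Real.Gamma_eq_integral hs, mul_comm (Real.exp _)]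
  have hint : IntegrableOn (fun t : ℝ => t ^ (s - 1) * Real.exp (-t)) (Set.Ioi 0) := by
    simpa only [mul_comm] using Real.GammaIntegral_convergent hs
  refine (aecover_Ioi_of_Ioi (tendsto_id'.2 nhdsWithin_le_nhds)
    ).integral_tendsto_of_countably_generated (l := 𝓝[>] (0 : ℝ)) hint |>.congr' ?_
  filter_upwards [self_mem_nhdsWithin] with x hx
  rw [id, Measure.restrict_restrict measurableSet_Ioi,
    Set.inter_eq_left.2 (Set.Ioi_subset_Ioi (le_of_lt hx)), upperGamma]

lemma exp_neg_one_mul_neg_log_le_upperGamma_zero (hx : 0 < x) (hx1 : x ≤ 1) :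
    Real.exp (-1) * -Real.log x ≤ upperGamma 0 x := by
  calc Real.exp (-1) * -Real.log x = ∫ t in x..1, t⁻¹ * Real.exp (-1) := by
        rw [intervalIntegral.integral_mul_const, integral_inv_of_pos hx one_pos, one_div,
          Real.log_inv, mul_comm]
    _ ≤ ∫ t in x..1, t ^ ((0 : ℝ) - 1) * Real.exp (-t) := by
        refine intervalIntegral.integral_mono_on hx1 ?_ ?_ fun t ht => ?_
        · exact ContinuousOn.intervalIntegrable_of_Icc hx1
            ((continuousOn_inv₀.mono fun t ht => (hx.trans_le ht.1).ne').mul continuousOn_const)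
        · exact (intervalIntegrable_iff_integrableOn_Ioc_of_le hx1).2
            ((integrableOn_rpow_mul_exp_neg_Ioi _ hx).mono_set Set.Ioc_subset_Ioi_self)
        · have ht0 : 0 < t := hx.trans_le ht.1
          rw [zero_sub, Real.rpow_neg_one]
          gcongr
          exact ht.2
    _ = upperGamma 0 x - upperGamma 0 1 := (upperGamma_sub_upperGamma 0 hx hx1).symm
    _ ≤ upperGamma 0 x := sub_le_self _ (upperGamma_nonneg 0 zero_le_one)

lemma tendsto_upperGamma_zero_nhdsGT_zero : Tendsto (upperGamma 0) (𝓝[>] 0) atTop := by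
  refine tendsto_atTop_mono' _ ?_ ((tendsto_neg_atBot_atTop.comp
    Real.tendsto_log_nhdsGT_zero).const_mul_atTop (Real.exp_pos (-1)))
  filter_upwards [Ioc_mem_nhdsGT one_pos] with x hx
  exact exp_neg_one_mul_neg_log_le_upperGamma_zero hx.1 hx.2

lemma rpow_sub_one_mul_exp_neg_le {t : ℝ} (hs : 0 ≤ s) (hs1 : s ≤ 1) (ht : 0 < t) :
    t ^ (s - 1) * Real.exp (-t) ≤ 2 * t ^ (-3 / 2 : ℝ) := by
  have h : t ^ (s + 1 / 2) ≤ 2 * Real.exp t :=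
    calc t ^ (s + 1 / 2) ≤ t ^ (0 : ℝ) + t ^ (2 : ℝ) :=
          rpow_le_rpow_add_rpow ht (by linarith) (by linarith)
      _ = 1 + t ^ 2 := by rw [Real.rpow_zero, Real.rpow_two]
      _ ≤ 2 * Real.exp t := by linarith [Real.quadratic_le_exp_of_nonneg ht.le]
  calc t ^ (s - 1) * Real.exp (-t) = t ^ (-3 / 2 : ℝ) * t ^ (s + 1 / 2) * Real.exp (-t) := by
        rw [← Real.rpow_add ht]; ring_nf
    _ ≤ t ^ (-3 / 2 : ℝ) * (2 * Real.exp t) * Real.exp (-t) := by gcongr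
    _ = 2 * t ^ (-3 / 2 : ℝ) := by rw [Real.exp_neg]; field_simp

lemma upperGamma_le (hs : 0 ≤ s) (hs1 : s ≤ 1) (hx : 0 < x) :
    upperGamma s x ≤ 4 * x ^ (-1 / 2 : ℝ) :=
  calc upperGamma s x ≤ ∫ t in Set.Ioi x, 2 * t ^ (-3 / 2 : ℝ) :=
        setIntegral_mono_on (integrableOn_rpow_mul_exp_neg_Ioi _ hx)
          ((integrableOn_Ioi_rpow_of_lt (by norm_num) hx).const_mul 2) measurableSet_Ioi
          fun _ ht => rpow_sub_one_mul_exp_neg_le hs hs1 (hx.trans ht)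
    _ = 4 * x ^ (-1 / 2 : ℝ) := by
        rw [integral_const_mul, integral_Ioi_rpow_of_lt (by norm_num) hx]
        ring_nf

lemma exists_pos_upperGamma_le (s : ℝ) (hy : 0 < y) : ∃ x, 0 < x ∧ upperGamma s x ≤ y :=
  ((eventually_gt_atTop 0).and
    ((tendsto_upperGamma_atTop s).eventually_le_const hy)).exists

lemma tailInv_upperGamma_pos (hy : 0 < y) (h : ∀ᶠ x in 𝓝[>] 0, y < upperGamma s x) :
    0 < tailInv (upperGamma s) y := by
  obtain ⟨x, hxy, hx⟩ := (h.and self_mem_nhdsWithin).exists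
  exact lt_of_lt_of_le hx
    (le_tailInv (strictAntiOn_upperGamma s).antitoneOn (exists_pos_upperGamma_le s hy) hx hxy)

lemma tailInv_upperGamma_le (hs : 0 ≤ s) (hs1 : s ≤ 1) (hy : 0 < y) :
    tailInv (upperGamma s) y ≤ 16 / y ^ 2 := by
  have hx : 0 < 16 / y ^ 2 := by positivity
  refine tailInv_le hx ((upperGamma_le hs hs1 hx).trans_eq ?_)
  have hsq : 16 / y ^ 2 = (4 / y) ^ (2 : ℝ) := by rw [Real.rpow_two]; ring
  rw [hsq, ← Real.rpow_mul (by positivity), show (2 : ℝ) * (-1 / 2) = -1 by norm_num,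
    Real.rpow_neg_one]
  field_simp

lemma tendsto_tailInv_upperGamma {ι : Type*} {l : Filter ι} {σ Y : ι → ℝ}
    (hσ : Tendsto σ l (𝓝 s)) (hY : Tendsto Y l (𝓝 y)) (hy : 0 < y) :
    Tendsto (fun i => tailInv (upperGamma (σ i)) (Y i)) l (𝓝 (tailInv (upperGamma s) y)) :=
  tendsto_tailInv (.of_forall fun _ => (strictAntiOn_upperGamma _).antitoneOn)
    (strictAntiOn_upperGamma s)
    (fun _ hx => ((continuous_upperGamma_left hx).tendsto s).comp hσ) hY
    (exists_pos_upperGamma_le s hy)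

end UpperGamma

section GammaMeasure

variable {α r : ℝ}

lemma ae_pos_gammaMeasure (α r : ℝ) : ∀ᵐ x ∂(gammaMeasure α r), 0 < x := by
  rw [gammaMeasure,
    ae_withDensity_iff (show Measurable (gammaPDF α r) from
      (measurable_gammaPDFReal α r).ennreal_ofReal)]
  filter_upwards [Measure.ae_ne volume 0] with x hx0 hx
  exact lt_of_le_of_ne (le_of_not_gt fun hneg => hx (gammaPDF_of_neg hneg)) hx0.symm

lemma integral_id_gammaMeasure (hα : 0 < α) (hr : 0 < r) :
    ∫ x, x ∂(gammaMeasure α r) = α / r := by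
  have hΓ := (Real.Gamma_pos_of_pos hα).ne'
  have hdensity : ∀ x ∈ Set.Ioi (0 : ℝ), (gammaPDF α r x).toReal • x =
      r ^ α / Real.Gamma α * (x ^ (α + 1 - 1) * Real.exp (-(r * x))) := fun x hx => by
    have hx : 0 < x := hx
    rw [gammaPDF, ENNReal.toReal_ofReal (gammaPDFReal_nonneg hα hr x), gammaPDFReal,
      if_pos hx.le, add_sub_right_comm, Real.rpow_add_one hx.ne', smul_eq_mul]
    ring
  calc ∫ x, x ∂(gammaMeasure α r)
      = ∫ x in Set.Ioi (0 : ℝ), x ∂(gammaMeasure α r) := by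
        rw [Measure.restrict_eq_self_of_ae_mem (s := Set.Ioi 0) (ae_pos_gammaMeasure α r)]
    _ = ∫ x in Set.Ioi 0, (gammaPDF α r x).toReal • x :=
        setIntegral_withDensity_eq_setIntegral_toReal_smul
          (measurable_gammaPDFReal α r).ennreal_ofReal
          (ae_of_all _ fun _ => ENNReal.ofReal_lt_top) _ measurableSet_Ioi
    _ = r ^ α / Real.Gamma α * ((1 / r) ^ (α + 1) * Real.Gamma (α + 1)) := by
        rw [setIntegral_congr_fun measurableSet_Ioi hdensity, integral_const_mul,
          Real.integral_rpow_mul_exp_neg_mul_Ioi (by positivity) hr]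
    _ = α / r := by
        rw [Real.Gamma_add_one hα.ne', Real.rpow_add_one (by positivity), one_div,
          Real.inv_rpow hr.le]
        field_simp

lemma gammaCoCDF_of_nonpos (hα : 0 < α) {x : ℝ} (hx : x ≤ 0) : gammaCoCDF α x = 1 := by
  have := isProbabilityMeasure_gammaMeasure hα one_pos
  have hIoi : Set.Ioi x ∈ ae (gammaMeasure α 1) :=
    (ae_pos_gammaMeasure α 1).mono fun _ ht => hx.trans_lt ht
  rw [gammaCoCDF, measureReal_def, (mem_ae_iff_prob_eq_one measurableSet_Ioi).1 hIoi,
    ENNReal.toReal_one]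

lemma gammaCoCDF_of_nonneg (hα : 0 < α) {x : ℝ} (hx : 0 ≤ x) :
    gammaCoCDF α x = (Real.Gamma α)⁻¹ * upperGamma α x := by
  have hdensity : ∀ t ∈ Set.Ioi x, (Real.Gamma α)⁻¹ * (t ^ (α - 1) * Real.exp (-t)) =
      gammaPDFReal α 1 t := fun t ht => by
    rw [gammaPDFReal, if_pos (hx.trans (le_of_lt ht)), Real.one_rpow, one_mul]
    ring
  rw [gammaCoCDF, gammaMeasure, measureReal_def, withDensity_apply _ measurableSet_Ioi, upperGamma,
    ← integral_const_mul, setIntegral_congr_fun measurableSet_Ioi hdensity,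
    integral_eq_lintegral_of_nonneg_ae (ae_of_all _ fun t => gammaPDFReal_nonneg hα one_pos t)
      (measurable_gammaPDFReal α 1).aestronglyMeasurable]
  rfl

lemma gammaCoCDFInv_eq_tailInv (hα : 0 < α) {p : ℝ} (hp : p < 1) :
    gammaCoCDFInv α p = tailInv (upperGamma α) (Real.Gamma α * p) := by
  rw [gammaCoCDFInv, tailInv]
  congr 1 with x
  rcases le_or_gt x 0 with hx | hx
  · simp [gammaCoCDF_of_nonpos hα hx, hp, hx.not_gt]
  · simp [gammaCoCDF_of_nonneg hα hx.le, inv_mul_le_iff₀ (Real.Gamma_pos_of_pos hα), hx]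

lemma gammaCoCDFInv_pos (hα : 0 < α) {p : ℝ} (hp : 0 < p) (hp1 : p < 1) :
    0 < gammaCoCDFInv α p := by
  have hΓ := Real.Gamma_pos_of_pos hα
  rw [gammaCoCDFInv_eq_tailInv hα hp1]
  exact tailInv_upperGamma_pos (by positivity)
    ((tendsto_upperGamma_nhdsGT_zero hα).eventually_const_lt (mul_lt_of_lt_one_right hΓ hp1))

end GammaMeasure

section LevyTail

variable {a y : ℝ}

lemma levyTail_eq_mul_upperGamma (a : ℝ) : levyTail a = fun x => a * upperGamma 0 x := by
  simp only [funext_iff, levyTail, upperGamma, zero_sub, Real.rpow_neg_one, implies_true]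

lemma levyTailInv_eq_tailInv (ha : 0 < a) (y : ℝ) :
    levyTailInv a y = tailInv (upperGamma 0) (y / a) := by
  rw [← tailInv_const_mul ha, ← levyTail_eq_mul_upperGamma, tailInv, levyTailInv]

lemma levyTailInv_pos (ha : 0 < a) (hy : 0 < y) : 0 < levyTailInv a y := by
  rw [levyTailInv_eq_tailInv ha]
  exact tailInv_upperGamma_pos (by positivity)
    (tendsto_upperGamma_zero_nhdsGT_zero.eventually_gt_atTop _)

lemma levyTailInv_le (ha : 0 < a) (hy : 0 < y) : levyTailInv a y ≤ 16 * a ^ 2 * (y ^ 2)⁻¹ := by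
  rw [levyTailInv_eq_tailInv ha]
  refine (tailInv_upperGamma_le le_rfl zero_le_one (by positivity)).trans_eq ?_
  field_simp

end LevyTail

section ArrivalTimes

variable {a : ℝ} {S : ℕ → ℝ} {N i : ℕ}

/-- The unnormalised weights `G_{a/N}⁻¹(S_{i+1} / S_{N+1})` of the finite approximation along a
path `S` of arrival times, extended by `0` to the indices `i ≥ N` so that the approximations and
their limit are all indexed by `ℕ`. -/
noncomputable def gammaJump (a : ℝ) (S : ℕ → ℝ) (N i : ℕ) : ℝ :=
  if i < N then gammaCoCDFInv (a / N) (S (i + 1) / S (N + 1)) else 0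

lemma gammaJump_of_lt (a : ℝ) (S : ℕ → ℝ) (hi : i < N) :
    gammaJump a S N i = gammaCoCDFInv (a / N) (S (i + 1) / S (N + 1)) :=
  if_pos hi

lemma gammaJump_of_not_lt (a : ℝ) (S : ℕ → ℝ) (hi : ¬i < N) : gammaJump a S N i = 0 :=
  if_neg hi

lemma div_succ_mem_Ioo (hS : StrictMono S) (hS0 : 0 ≤ S 0) (hi : i < N) :
    S (i + 1) / S (N + 1) ∈ Set.Ioo (0 : ℝ) 1 := by
  have hpos : ∀ n, 0 < S (n + 1) := fun n => hS0.trans_lt (hS n.succ_pos)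
  exact ⟨div_pos (hpos i) (hpos N), (div_lt_one (hpos N)).2 (hS (Nat.succ_lt_succ hi))⟩

lemma gammaJump_pos (ha : 0 < a) (hS : StrictMono S) (hS0 : 0 ≤ S 0) (hi : i < N) :
    0 < gammaJump a S N i := by
  obtain ⟨hp, hp1⟩ := div_succ_mem_Ioo hS hS0 hi
  rw [gammaJump_of_lt a S hi]
  exact gammaCoCDFInv_pos (div_pos ha (Nat.cast_pos.2 (Nat.zero_lt_of_lt hi))) hp hp1

lemma gammaJump_nonneg (ha : 0 < a) (hS : StrictMono S) (hS0 : 0 ≤ S 0) (N i : ℕ) :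
    0 ≤ gammaJump a S N i := by
  by_cases hi : i < N
  · exact (gammaJump_pos ha hS hS0 hi).le
  · exact (gammaJump_of_not_lt a S hi).ge

lemma gammaJump_eq_tailInv (ha : 0 < a) (hS : StrictMono S) (hS0 : 0 ≤ S 0) (hi : i < N) :
    gammaJump a S N i =
      tailInv (upperGamma (a / N)) (Real.Gamma (a / N) / S (N + 1) * S (i + 1)) := by
  rw [gammaJump_of_lt a S hi, gammaCoCDFInv_eq_tailInv
    (div_pos ha (Nat.cast_pos.2 (Nat.zero_lt_of_lt hi))) (div_succ_mem_Ioo hS hS0 hi).2,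
    mul_div_assoc', div_mul_eq_mul_div]

lemma tendsto_self_mul_Gamma_nhdsNE_zero :
    Tendsto (fun x : ℝ => x * Real.Gamma x) (𝓝[≠] 0) (𝓝 1) := by
  have hcont : ContinuousAt Real.Gamma (0 + 1) := by
    rw [zero_add]
    exact (Real.differentiableAt_Gamma fun m => by
      have : (0 : ℝ) ≤ m := m.cast_nonneg
      linarith).continuousAt
  have h : Tendsto (fun x : ℝ => Real.Gamma (x + 1)) (𝓝[≠] 0) (𝓝 (Real.Gamma (0 + 1))) :=
    (hcont.tendsto.comp (tendsto_id.add_const 1)).mono_left nhdsWithin_le_nhds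
  rw [zero_add, Real.Gamma_one] at h
  refine h.congr' ?_
  filter_upwards [self_mem_nhdsWithin] with x hx
  exact Real.Gamma_add_one hx

lemma tendsto_Gamma_div_succ (ha : a ≠ 0) (hlim : Tendsto (fun n : ℕ => S n / n) atTop (𝓝 1)) :
    Tendsto (fun N : ℕ => Real.Gamma (a / N) / S (N + 1)) atTop (𝓝 a⁻¹) := by
  have hGamma : Tendsto (fun N : ℕ => a / N * Real.Gamma (a / N)) atTop (𝓝 1) := by
    refine tendsto_self_mul_Gamma_nhdsNE_zero.comp (tendsto_nhdsWithin_iff.2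
      ⟨tendsto_const_div_atTop_nhds_zero_nat a, ?_⟩)
    filter_upwards [eventually_ne_atTop 0] with N hN
    exact div_ne_zero ha (Nat.cast_ne_zero.2 hN)
  have hratio : Tendsto (fun N : ℕ => (N : ℝ) / (N + 1) * (S (N + 1) / (N + 1 : ℕ))⁻¹) atTop
      (𝓝 (1 * 1⁻¹)) :=
    (tendsto_natCast_div_add_atTop (1 : ℝ)).mul
      (((tendsto_add_atTop_iff_nat 1).2 hlim).inv₀ one_ne_zero)
  have h := (hGamma.mul hratio).const_mul a⁻¹
  rw [inv_one, one_mul, one_mul, mul_one] at h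
  refine h.congr' ?_
  filter_upwards [eventually_ne_atTop 0] with N hN
  push_cast
  field_simp

lemma summable_inv_sq_of_tendsto_div {c : ℝ} (hc : c ≠ 0)
    (hlim : Tendsto (fun n : ℕ => S n / n) atTop (𝓝 c)) : Summable fun n => (S n ^ 2)⁻¹ := by
  refine summable_of_isBigO_nat (Real.summable_nat_pow_inv.2 one_lt_two)
    (Asymptotics.isBigO_of_div_tendsto_nhds ?_ (c ^ 2)⁻¹ ?_)
  · filter_upwards [eventually_ne_atTop 0] with n hn h
    exact absurd h (by positivity)
  · refine ((hlim.pow 2).inv₀ (pow_ne_zero 2 hc)).congr fun n => ?_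
    rw [Pi.div_apply, div_pow, inv_div, inv_div_inv]

lemma tendsto_gammaJump (ha : 0 < a) (hS : StrictMono S) (hS0 : 0 ≤ S 0)
    (hlim : Tendsto (fun n : ℕ => S n / n) atTop (𝓝 1)) (i : ℕ) :
    Tendsto (fun N => gammaJump a S N i) atTop (𝓝 (levyTailInv a (S (i + 1)))) := by
  have hpos : 0 < S (i + 1) := hS0.trans_lt (hS i.succ_pos)
  rw [levyTailInv_eq_tailInv ha, div_eq_inv_mul]
  refine (tendsto_tailInv_upperGamma (tendsto_const_div_atTop_nhds_zero_nat a)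
    ((tendsto_Gamma_div_succ ha.ne' hlim).mul_const _) (by positivity)).congr' ?_
  filter_upwards [eventually_gt_atTop i] with N hi
  exact (gammaJump_eq_tailInv ha hS hS0 hi).symm

lemma eventually_gammaJump_le (ha : 0 < a) (hS : StrictMono S) (hS0 : 0 ≤ S 0)
    (hlim : Tendsto (fun n : ℕ => S n / n) atTop (𝓝 1)) :
    ∀ᶠ N in atTop, ∀ i, gammaJump a S N i ≤ 64 * a ^ 2 * (S (i + 1) ^ 2)⁻¹ := by
  have half_inv_lt : a⁻¹ / 2 < a⁻¹ := half_lt_self (by positivity)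
  filter_upwards [(tendsto_const_div_atTop_nhds_zero_nat a).eventually_le_const one_pos,
    (tendsto_Gamma_div_succ ha.ne' hlim).eventually_const_le half_inv_lt] with N hN hfactor i
  have hpos : 0 < S (i + 1) := hS0.trans_lt (hS i.succ_pos)
  by_cases hi : i < N
  · have hfactor_pos : 0 < Real.Gamma (a / N) / S (N + 1) :=
      lt_of_lt_of_le (by positivity) hfactor
    calc gammaJump a S N i
        ≤ 16 / (Real.Gamma (a / N) / S (N + 1) * S (i + 1)) ^ 2 := by
          rw [gammaJump_eq_tailInv ha hS hS0 hi]
          exact tailInv_upperGamma_le (by positivity) hN (by positivity)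
      _ ≤ 16 / (a⁻¹ / 2 * S (i + 1)) ^ 2 := by gcongr
      _ = 64 * a ^ 2 * (S (i + 1) ^ 2)⁻¹ := by field_simp; norm_num
  · rw [gammaJump_of_not_lt a S hi]
    positivity

end ArrivalTimes

section NormalizedDiracSum

variable {X : Type*} [MeasurableSpace X] {w : ℕ → ℝ} {y : ℕ → X} {s : Set X}

/-- The discrete measure whose mass at the atom `y i` is proportional to the weight `w i`. It is a
probability measure when the weights are nonnegative with a positive finite sum. -/
noncomputable def normalizedDiracSum (w : ℕ → ℝ) (y : ℕ → X) : Measure X :=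
  Measure.sum fun i => ENNReal.ofReal (w i / ∑' j, w j) • Measure.dirac (y i)

lemma normalizedDiracSum_real (hw : ∀ i, 0 ≤ w i) (hsum : Summable w) (y : ℕ → X)
    (hs : MeasurableSet s) :
    (normalizedDiracSum w y).real s = (∑' i, w i * s.indicator 1 (y i)) / ∑' i, w i := by
  have hmass : ∀ i, (ENNReal.ofReal (w i / ∑' j, w j) • Measure.dirac (y i)) s =
      ENNReal.ofReal (w i * s.indicator 1 (y i) / ∑' j, w j) := fun i => by
    by_cases h : y i ∈ s <;> simp [hs, h]
  have hmul_nonneg : ∀ i, 0 ≤ w i * s.indicator 1 (y i) := fun i =>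
    mul_nonneg (hw i) (Set.indicator_nonneg (fun _ _ => zero_le_one) _)
  have hnonneg : ∀ i, 0 ≤ w i * s.indicator 1 (y i) / ∑' j, w j := fun i =>
    div_nonneg (hmul_nonneg i) (tsum_nonneg hw)
  have hsummable : Summable fun i => w i * s.indicator 1 (y i) :=
    hsum.of_nonneg_of_le hmul_nonneg fun i =>
      mul_le_of_le_one_right (hw i) (Set.indicator_le_self' (fun _ _ => zero_le_one) _)
  rw [measureReal_def, normalizedDiracSum, Measure.sum_apply _ hs, tsum_congr hmass,
    ← ENNReal.ofReal_tsum_of_nonneg hnonneg (hsummable.div_const _),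
    ENNReal.toReal_ofReal (tsum_nonneg hnonneg), tsum_div_const]

lemma isProbabilityMeasure_normalizedDiracSum (hw : ∀ i, 0 ≤ w i) (hsum : Summable w) {i : ℕ}
    (hi : 0 < w i) (y : ℕ → X) : IsProbabilityMeasure (normalizedDiracSum w y) := by
  have h := normalizedDiracSum_real hw hsum y .univ
  simp only [Set.indicator_univ, Pi.one_apply, mul_one,
    div_self (hsum.tsum_pos hw i hi).ne'] at h
  exact ⟨(ENNReal.toReal_eq_one_iff _).1 h⟩

lemma tendsto_normalizedDiracSum_real {ι : Type*} {l : Filter ι} [l.NeBot] {u : ι → ℕ → ℝ}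
    {b : ℕ → ℝ} (hb : Summable b) (hu : ∀ n i, 0 ≤ u n i) (hub : ∀ᶠ n in l, ∀ i, u n i ≤ b i)
    (huw : ∀ i, Tendsto (fun n => u n i) l (𝓝 (w i))) {i : ℕ} (hi : 0 < w i) (y : ℕ → X)
    (hs : MeasurableSet s) :
    Tendsto (fun n => (normalizedDiracSum (u n) y).real s) l
      (𝓝 ((normalizedDiracSum w y).real s)) := by
  have hw : ∀ i, 0 ≤ w i := fun i => ge_of_tendsto' (huw i) fun n => hu n i
  have hwsum : Summable w := hb.of_nonneg_of_le hw fun i =>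
    le_of_tendsto (huw i) (hub.mono fun n hn => hn i)
  have hweights : Tendsto (fun n => ∑' i, u n i) l (𝓝 (∑' i, w i)) :=
    tendsto_tsum_of_dominated_convergence hb huw <| hub.mono fun n hn i => by
      rw [Real.norm_of_nonneg (hu n i)]
      exact hn i
  have hmasses : Tendsto (fun n => ∑' i, u n i * s.indicator 1 (y i)) l
      (𝓝 (∑' i, w i * s.indicator 1 (y i))) :=
    tendsto_tsum_of_dominated_convergence hb (fun i => (huw i).mul_const _) <|
      hub.mono fun n hn i => by
        have indicator_nonneg : 0 ≤ s.indicator (1 : X → ℝ) (y i) :=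
          Set.indicator_nonneg (fun _ _ => zero_le_one) _
        have indicator_le_one : s.indicator (1 : X → ℝ) (y i) ≤ 1 :=
          Set.indicator_le_self' (fun _ _ => zero_le_one) _
        rw [Real.norm_of_nonneg (mul_nonneg (hu n i) indicator_nonneg)]
        exact (mul_le_of_le_one_right (hu n i) indicator_le_one).trans (hn i)
  rw [normalizedDiracSum_real hw hwsum y hs]
  refine (hmasses.div hweights (hwsum.tsum_pos hw i hi).ne').congr' ?_
  filter_upwards [hub] with n hn
  exact (normalizedDiracSum_real (hu n) (hb.of_nonneg_of_le (hu n) hn) y hs).symm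

end NormalizedDiracSum

lemma tendsto_dCvM {ι : Type*} {l : Filter ι} [l.IsCountablyGenerated] {F : ι → Measure ℝ}
    {P : Measure ℝ} (G : Measure ℝ) [IsFiniteMeasure G]
    (h : ∀ x, Tendsto (fun n => cdf (F n) x) l (𝓝 (cdf P x))) :
    Tendsto (fun n => dCvM (F n) G) l (𝓝 (dCvM P G)) := by
  refine tendsto_integral_filter_of_dominated_convergence (fun _ => (1 : ℝ))
    (.of_forall fun n => ?_) (.of_forall fun n => ae_of_all _ fun x => ?_)
    (integrable_const 1) (ae_of_all _ fun x => ((h x).sub_const _).pow 2)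
  · exact (((monotone_cdf (F n)).measurable.sub (monotone_cdf G).measurable).pow_const
      2).aestronglyMeasurable
  · rw [Real.norm_of_nonneg (sq_nonneg _), sq_le_one_iff_abs_le_one]
    exact abs_sub_le_iff.2 ⟨by linarith [cdf_le_one (F n) x, cdf_nonneg G x],
      by linarith [cdf_nonneg (F n) x, cdf_le_one G x]⟩

section Paths

variable {Ω : Type*} {a : ℝ} {E : ℕ → Ω → ℝ} {ω : Ω}

lemma strictMono_arrival (hE : ∀ k, 0 < E k ω) : StrictMono fun n => arrival E n ω :=
  strictMono_nat_of_lt_succ fun n => by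
    simpa only [arrival, Finset.sum_range_succ] using lt_add_of_pos_right _ (hE n)

lemma arrival_zero (E : ℕ → Ω → ℝ) (ω : Ω) : arrival E 0 ω = 0 :=
  Finset.sum_range_zero _

lemma arrival_succ_pos (hE : ∀ k, 0 < E k ω) (n : ℕ) : 0 < arrival E (n + 1) ω :=
  (arrival_zero E ω).symm.trans_lt (strictMono_arrival hE n.succ_pos)

lemma fergusonSeries_eq_normalizedDiracSum (a : ℝ) (E Y : ℕ → Ω → ℝ) (ω : Ω) :
    fergusonSeries a E Y ω =
      normalizedDiracSum (fun i => levyTailInv a (arrival E (i + 1) ω)) fun i => Y i ω :=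
  rfl

lemma approxProcess_eq_normalizedDiracSum (a : ℝ) (E Y : ℕ → Ω → ℝ) (N : ℕ) (ω : Ω) :
    approxProcess a E Y N ω =
      normalizedDiracSum (gammaJump a (fun n => arrival E n ω) N) fun i => Y i ω := by
  have hsum : ∑' j, gammaJump a (fun n => arrival E n ω) N j = ∑ j ∈ Finset.range N,
      gammaCoCDFInv (a / N) (arrival E (j + 1) ω / arrival E (N + 1) ω) := by
    rw [tsum_eq_sum (s := Finset.range N) fun j hj =>
      gammaJump_of_not_lt _ _ (Finset.mem_range.not.1 hj)]
    exact Finset.sum_congr rfl fun j hj => gammaJump_of_lt _ _ (Finset.mem_range.1 hj)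
  ext s hs
  rw [approxProcess, normalizedDiracSum, Measure.finsetSum_apply, Measure.sum_apply _ hs, hsum,
    tsum_eq_sum (s := Finset.range N) fun i hi => by
      simp [gammaJump_of_not_lt _ _ (Finset.mem_range.not.1 hi)]]
  refine Finset.sum_congr rfl fun i hi => ?_
  rw [approxWeight, gammaJump_of_lt _ _ (Finset.mem_range.1 hi)]

lemma isProbabilityMeasure_fergusonSeries (ha : 0 < a) (hE : ∀ k, 0 < E k ω)
    (hlim : Tendsto (fun n : ℕ => arrival E n ω / n) atTop (𝓝 1)) (Y : ℕ → Ω → ℝ) :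
    IsProbabilityMeasure (fergusonSeries a E Y ω) := by
  have hpos : ∀ i, 0 < levyTailInv a (arrival E (i + 1) ω) := fun i =>
    levyTailInv_pos ha (arrival_succ_pos hE i)
  have hsum : Summable fun i => levyTailInv a (arrival E (i + 1) ω) :=
    (((summable_nat_add_iff 1).2 (summable_inv_sq_of_tendsto_div one_ne_zero hlim)).mul_left
      (16 * a ^ 2)).of_nonneg_of_le (fun i => (hpos i).le)
        fun i => levyTailInv_le ha (arrival_succ_pos hE i)
  exact isProbabilityMeasure_normalizedDiracSum (fun i => (hpos i).le) hsum (hpos 0) _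

lemma isProbabilityMeasure_approxProcess (ha : 0 < a) (hE : ∀ k, 0 < E k ω) (Y : ℕ → Ω → ℝ)
    {N : ℕ} (hN : 1 ≤ N) : IsProbabilityMeasure (approxProcess a E Y N ω) := by
  have hS := strictMono_arrival hE
  have hS0 := (arrival_zero E ω).ge
  have hsum : Summable (gammaJump a (fun n => arrival E n ω) N) :=
    summable_of_ne_finset_zero (s := Finset.range N) fun i hi =>
      gammaJump_of_not_lt _ _ (Finset.mem_range.not.1 hi)
  rw [approxProcess_eq_normalizedDiracSum]
  exact isProbabilityMeasure_normalizedDiracSum (gammaJump_nonneg ha hS hS0 N) hsum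
    (gammaJump_pos ha hS hS0 hN) _

lemma tendsto_approxProcess_real (ha : 0 < a) (hE : ∀ k, 0 < E k ω)
    (hlim : Tendsto (fun n : ℕ => arrival E n ω / n) atTop (𝓝 1)) (Y : ℕ → Ω → ℝ) {s : Set ℝ}
    (hs : MeasurableSet s) :
    Tendsto (fun N => (approxProcess a E Y N ω).real s) atTop
      (𝓝 ((fergusonSeries a E Y ω).real s)) := by
  have hS := strictMono_arrival hE
  have hS0 := (arrival_zero E ω).ge
  have hbound : Summable fun i => 64 * a ^ 2 * (arrival E (i + 1) ω ^ 2)⁻¹ :=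
    ((summable_nat_add_iff 1).2 (summable_inv_sq_of_tendsto_div one_ne_zero hlim)).mul_left _
  simp only [approxProcess_eq_normalizedDiracSum, fergusonSeries_eq_normalizedDiracSum]
  exact tendsto_normalizedDiracSum_real hbound (gammaJump_nonneg ha hS hS0)
    (eventually_gammaJump_le ha hS hS0 hlim) (tendsto_gammaJump ha hS hS0 hlim)
    (levyTailInv_pos ha (arrival_succ_pos hE 0)) _ hs

lemma tendsto_cdf_approxProcess (ha : 0 < a) (hE : ∀ k, 0 < E k ω)
    (hlim : Tendsto (fun n : ℕ => arrival E n ω / n) atTop (𝓝 1)) (Y : ℕ → Ω → ℝ) (x : ℝ) :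
    Tendsto (fun N => cdf (approxProcess a E Y N ω) x) atTop
      (𝓝 (cdf (fergusonSeries a E Y ω) x)) := by
  have := isProbabilityMeasure_fergusonSeries ha hE hlim Y
  rw [cdf_eq_real]
  refine (tendsto_approxProcess_real ha hE hlim Y measurableSet_Iic).congr' ?_
  filter_upwards [eventually_ge_atTop 1] with N hN
  have := isProbabilityMeasure_approxProcess ha hE Y hN
  rw [cdf_eq_real]

end Paths

theorem lemma2_general {Ω : Type*} [MeasurableSpace Ω] {μ : Measure Ω} {a : ℝ} (ha : 0 < a)
    (G : Measure ℝ) [IsProbabilityMeasure G] {E : ℕ → Ω → ℝ} (Y : ℕ → Ω → ℝ)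
    (hident : ∀ k, IdentDistrib (E k) (E 0) μ μ)
    (hindep : Pairwise fun i j => IndepFun (E i) (E j) μ)
    (hpos : ∀ᵐ ω ∂μ, 0 < E 0 ω) (hmean : ∫ ω, E 0 ω ∂μ = 1) :
    ∀ᵐ ω ∂μ,
      IsProbabilityMeasure (fergusonSeries a E Y ω) ∧
      (∀ N : ℕ, 1 ≤ N → IsProbabilityMeasure (approxProcess a E Y N ω)) ∧
      Tendsto (fun N : ℕ => dCvM (approxProcess a E Y N ω) G) atTop
        (𝓝 (dCvM (fergusonSeries a E Y ω) G)) := by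
  have hE : ∀ᵐ ω ∂μ, ∀ k, 0 < E k ω := ae_all_iff.2 fun k =>
    (hident k).symm.ae_snd measurableSet_Ioi hpos
  have hint : Integrable (E 0) μ := .of_integral_ne_zero (hmean ▸ one_ne_zero)
  filter_upwards [hE, strong_law_ae_real E hint hindep hident] with ω hω hlim
  rw [hmean] at hlim
  exact ⟨isProbabilityMeasure_fergusonSeries ha hω hlim Y,
    fun N hN => isProbabilityMeasure_approxProcess ha hω Y hN,
    tendsto_dCvM G (tendsto_cdf_approxProcess ha hω hlim Y)⟩

theorem lemma2 {Ω : Type*} [MeasurableSpace Ω] (μ : Measure Ω) [IsProbabilityMeasure μ]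
    (a : ℝ) (ha : 0 < a)
    (H G : Measure ℝ) [IsProbabilityMeasure H] [IsProbabilityMeasure G]
    (E Y : ℕ → Ω → ℝ)
    (hE : ∀ k, HasLaw (E k) (expMeasure 1) μ) (hEind : iIndepFun E μ)
    (hY : ∀ i, HasLaw (Y i) H μ) (hYind : iIndepFun Y μ)
    (hYE : IndepFun (fun ω i => Y i ω) (fun ω k => arrival E (k + 1) ω) μ) :
    ∀ᵐ ω ∂μ,
      IsProbabilityMeasure (fergusonSeries a E Y ω) ∧
      (∀ N : ℕ, 1 ≤ N → IsProbabilityMeasure (approxProcess a E Y N ω)) ∧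
      Tendsto (fun N : ℕ => dCvM (approxProcess a E Y N ω) G) atTop
        (𝓝 (dCvM (fergusonSeries a E Y ω) G)) :=
  lemma2_general ha G Y (fun k => (hE k).identDistrib (hE 0))
    (fun i j hij => hEind.indepFun hij)
    (((hE 0).ae_iff (measurable_const.lt measurable_id)).2 (ae_pos_gammaMeasure 1 1))
    (by rw [(hE 0).integral_eq, expMeasure, integral_id_gammaMeasure one_pos one_pos, div_one])
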